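/- Let $p\in[1,\infty)$ and $\mathbb{C}_{1/2}=\{s=\sigma+\mathrm{i}t:\sigma>1/2\}$. Let $H^p(\mathbb{C}_{1/2})$ be the space of holomorphic functions $f$ on $\mathbb{C}_{1/2}$ with $$\|f\|_{H^p}=\sup_{\sigma>1/2}\Big(\int_{\mathbb{R}}|f(\sigma+\mathrm{i}t)|^p\,\mathrm{d}t\Big)^{1/p}<\infty,$$ and let $\mathscr{H}^p$ be the closure of the Dirichlet polynomials $\sum a_n n^{-s}$ (finite sums over $n\ge 1$) in the norm $$\Big\|\sum a_n n^{-s}\Big\|_{\mathscr{H}^p}=\lim_{T\to\infty}\Big(\frac1{2T}\int_{-T}^{T}\Big|\sum a_n n^{-\mathrm{i}t}\Big|^p\,\mathrm{d}t\Big)^{1/p},$$ regarded as a space of functions on $\mathbb{C}_{1/2}$. For $X=H^p(\mathbb{C}_{1/2})$ or $X=\mathscr{H}^p$, a positive measure $\mu$ on $\mathbb{C}_{1/2}$ is called a Carleson measure for $X$ with constant $C>0$ if $\int_{\mathbb{C}_{1/2}}|f|^p\,\mathrm{d}\mu\le C\|f\|_X^p$ for all $f\in X$, and a Carleson measure for $X$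 if this holds with some $C>0$. A measure is called local if its support is bounded. The following statements are equivalent. (a) For every bounded interval $I\subset\mathbb{R}$ there is a constant $C>0$, depending only on $p$ and the length of $I$, such that for all finite sequences $(a_n)$ of complex numbers $$\int_I\Big|\sum a_n n^{-1/2-\mathrm{i}t}\Big|^p\,\mathrm{d}t\le C\,\Big\|\sum a_n n^{-s}\Big\|_{\mathscr{H}^p}^p .$$ (b) Every local Carleson measure for $H^p(\mathbb{C}_{1/2})$ is a Carleson measure for $\mathscr{H}^p$. (c) For every bounded set $\Gamma\subset\mathbb{C}_{1/2}$ there is a constant $D>0$ such that, for every finite or infinite sequence $S=(s_n)$ of points $s_n=\sigma_n+\mathrm{i}t_n$ of $\Gamma$ and every $C>0$, if $\mu_S=\sum_n(2\sigma_n-1)\delta_{s_n}$ is a Carleson measure for $H^p(\mathbb{C}_{1/2})$ with constant $C$, then $$\int|F(s)|^p\,\mathrm{d}\mu_S(s)\le CD\,\|F\|_{\mathscr{H}^p}^p\qquad\text{for all }F\in\mathscr{H}^p .$$ -/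

import Mathlib

open MeasureTheory Filter Topology
open scoped ENNReal NNReal

noncomputable section

namespace DirichletHardy

/-- The half-plane `σ > 1/2`, where `s = σ + i t`. -/
def halfPlane : Set ℂ := {s : ℂ | 1 / 2 < s.re}

/-- The Dirichlet polynomial `∑ a_n n^{-s}` with finite coefficient sequence `(a_n)`, `n ≥ 1`. -/
def dirichletPoly (a : ℕ+ →₀ ℂ) (s : ℂ) : ℂ :=
  a.sum fun n c => c * ((n : ℕ) : ℂ) ^ (-s)

/-- The norm of a Dirichlet polynomial,
`lim_{T → ∞} ((1 / 2T) ∫_{-T}^{T} |∑ a_n n^{-it}|^p dt)^{1/p}`.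
The function `t ↦ ∑ a_n n^{-it}` is almost periodic, hence the limit exists and is finite,
and it is the `limsup`. -/
def polyNorm (p : ℝ) (a : ℕ+ →₀ ℂ) : ℝ≥0∞ :=
  limsup (fun T : ℝ =>
    (ENNReal.ofReal (1 / (2 * T)) *
      ∫⁻ t in Set.Icc (-T) T, ‖dirichletPoly a (t * Complex.I)‖ₑ ^ p) ^ (1 / p)) atTop

/-- The sequence of Dirichlet polynomials with coefficients `P k` is Cauchy in the norm `polyNorm p`
and converges pointwise to `F` on the half-plane `σ > 1/2`; so `F` is the function on the half-plane
that represents the element of the completion given by this Cauchy sequence. -/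
structure Approximates (p : ℝ) (P : ℕ → ℕ+ →₀ ℂ) (F : ℂ → ℂ) : Prop where
  cauchy : ∀ ε : ℝ≥0∞, 0 < ε → ∃ N : ℕ, ∀ j ≥ N, ∀ k ≥ N, polyNorm p (P j - P k) ≤ ε
  tendsto : ∀ s ∈ halfPlane, Tendsto (fun k => dirichletPoly (P k) s) atTop (𝓝 (F s))

/-- Membership of (the restriction to `σ > 1/2` of) `F` in the Dirichlet-Hardy space `𝓗^p`, the
closure of the Dirichlet polynomials in the norm `polyNorm p`. -/
def MemDirichletHardy (p : ℝ) (F : ℂ → ℂ) : Prop :=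
  ∃ P : ℕ → ℕ+ →₀ ℂ, Approximates p P F

/-- The norm of `F` in `𝓗^p`, namely `lim_k ‖P_k‖` for an approximating sequence of Dirichlet
polynomials. The limit does not depend on the sequence, since an element of `𝓗^p` is determined
by its values on the half-plane; the infimum selects this common value (and `∞` outside `𝓗^p`). -/
def dirichletHardyNorm (p : ℝ) (F : ℂ → ℂ) : ℝ≥0∞ :=
  sInf {N : ℝ≥0∞ | ∃ P : ℕ → ℕ+ →₀ ℂ, Approximates p P F ∧
    Tendsto (fun k => polyNorm p (P k)) atTop (𝓝 N)}

/-- The norm of the classical Hardy space of the half-plane `σ > 1/2`,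
`sup_{σ > 1/2} (∫ |f(σ + i t)|^p dt)^{1/p}`. -/
def hardyNorm (p : ℝ) (f : ℂ → ℂ) : ℝ≥0∞ :=
  ⨆ (σ : ℝ) (_ : 1 / 2 < σ), (∫⁻ t : ℝ, ‖f (σ + t * Complex.I)‖ₑ ^ p) ^ (1 / p)

/-- Membership in the classical Hardy space `H^p` of the half-plane `σ > 1/2`. -/
def MemHardy (p : ℝ) (f : ℂ → ℂ) : Prop :=
  DifferentiableOn ℂ f halfPlane ∧ hardyNorm p f < ∞

/-- `μ` satisfies the Carleson inequality for `H^p` of the half-plane with constant `C`. -/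
def HardyCarlesonBound (p : ℝ) (μ : Measure ℂ) (C : ℝ≥0) : Prop :=
  ∀ f : ℂ → ℂ, MemHardy p f →
    ∫⁻ s in halfPlane, ‖f s‖ₑ ^ p ∂μ ≤ C * hardyNorm p f ^ p

/-- `μ` satisfies the Carleson inequality for `𝓗^p` with constant `C`. -/
def DirichletHardyCarlesonBound (p : ℝ) (μ : Measure ℂ) (C : ℝ≥0) : Prop :=
  ∀ F : ℂ → ℂ, MemDirichletHardy p F →
    ∫⁻ s in halfPlane, ‖F s‖ₑ ^ p ∂μ ≤ C * dirichletHardyNorm p F ^ p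

/-- `μ` is a Carleson measure for `H^p` of the half-plane `σ > 1/2`. -/
def IsHardyCarleson (p : ℝ) (μ : Measure ℂ) : Prop :=
  ∃ C : ℝ≥0, 0 < C ∧ HardyCarlesonBound p μ C

/-- `μ` is a Carleson measure for `𝓗^p`. -/
def IsDirichletHardyCarleson (p : ℝ) (μ : Measure ℂ) : Prop :=
  ∃ C : ℝ≥0, 0 < C ∧ DirichletHardyCarlesonBound p μ C

/-- A local measure on the half-plane: a positive Borel measure which lives on the half-plane
`σ > 1/2` and has bounded support. -/
def IsLocalMeasure (μ : Measure ℂ) : Prop :=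
  μ halfPlaneᶜ = 0 ∧ Bornology.IsBounded μ.support

/-- The measure `μ_S = ∑ (2 σ_n - 1) δ_{s_n}`. -/
def discreteMeasure {ι : Type} (s : ι → ℂ) : Measure ℂ :=
  Measure.sum fun n => ENNReal.ofReal (2 * (s n).re - 1) • Measure.dirac (s n)

end DirichletHardy

end

/-!
The equivalence of the local embedding with two statements on Carleson measures.

*The embedding controls local Carleson measures.* For a Dirichlet polynomial `F`, the Poisson formula
expresses the values on `σ = 1/2 + δ` as averages of vertical translates of the boundary values
(`integral_dirichletPoly_cauchyMeasure`). The constant of the embedding depends only on the length of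
the interval, so by Jensen's inequality it serves on all lines to the right of `σ = 1/2` as well. Hence
`F(s) (s + 1/2)⁻²` lies in `H^p` with norm at most a constant times that of `F`, the decay of the second
factor making the sum over unit intervals converge. On the support of a local measure that factor is
bounded below, so a Carleson inequality for `H^p` gives one for `F`; Fatou's lemma extends it to `𝓗^p`.

*Uniformity.* If the constants for discrete measures on a bounded set were not uniform, a weighted sum
of bad examples would be a local Carleson measure for `H^p` and not for `𝓗^p`
(`exists_uniform_bound_of_forall_local`).

*Discrete measures control the embedding.* A grid of mesh `ε` on `σ = 1/2 + ε` has a Carleson constant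
for `H^p` that does not depend on `ε`, since `|f|^p` is subharmonic and the discs of radius `ε/2` about
the grid points are disjoint (`hardyCarlesonBound_of_separated`). The resulting bound on
`∑ 2ε |F(s_n)|^p`, averaged over all vertical positions of the grid, is a bound for
`∫ |F(1/2 + ε + it)|^p dt`, and `ε → 0` gives the embedding on one interval. The norm of `𝓗^p` is
invariant under vertical translation, so the constant depends only on the length.
-/

noncomputable section

namespace DirichletHardy

/-! ### Jensen's inequality and the submean value property -/

theorem enorm_integral_rpow_le {α : Type*} [MeasurableSpace α] {ν : Measure α}
    [IsProbabilityMeasure ν] {p : ℝ} (hp : 1 ≤ p) {f : α → ℂ} (hf : AEStronglyMeasurable f ν) :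
    ‖∫ x, f x ∂ν‖ₑ ^ p ≤ ∫⁻ x, ‖f x‖ₑ ^ p ∂ν := by
  have h1 : eLpNorm f 1 ν ≤ eLpNorm f (ENNReal.ofReal p) ν :=
    eLpNorm_le_eLpNorm_of_exponent_le (by simpa using hp) hf
  have hp0 : 0 < p := by linarith
  rw [eLpNorm_one_eq_lintegral_enorm, eLpNorm_eq_lintegral_rpow_enorm_toReal (by simpa using hp0)
    ENNReal.ofReal_ne_top, ENNReal.toReal_ofReal hp0.le] at h1
  calc ‖∫ x, f x ∂ν‖ₑ ^ p ≤ ((∫⁻ x, ‖f x‖ₑ ^ p ∂ν) ^ (1 / p)) ^ p := by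
        gcongr
        exact (enorm_integral_le_lintegral_enorm f).trans h1
    _ = _ := by rw [← ENNReal.rpow_mul, one_div_mul_cancel hp0.ne', ENNReal.rpow_one]

open Real in
/-- The submean value property of `|f|^p` on discs, for holomorphic `f`: the mean value property
on each circle with Jensen's inequality, integrated over the radius in polar coordinates. -/
theorem ofReal_mul_enorm_rpow_le_setLIntegral_ball {p : ℝ} (hp : 1 ≤ p) {f : ℂ → ℂ}
    {s : ℂ} {ρ : ℝ} (hρ : 0 < ρ)
    (hf : DifferentiableOn ℂ f (Metric.ball s ρ)) :
    ENNReal.ofReal (π * ρ ^ 2) * ‖f s‖ₑ ^ p ≤ ∫⁻ z in Metric.ball s ρ, ‖f z‖ₑ ^ p := by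
  -- the submean inequality on each circle
  have hcirc : ∀ r ∈ Set.Ioo 0 ρ, ENNReal.ofReal (2 * π) * ‖f s‖ₑ ^ p ≤
      ∫⁻ θ in Set.Ioo (-π) π, ‖f (s + Complex.polarCoord.symm (r, θ))‖ₑ ^ p := by
    intro r hr
    have hsub : Metric.closedBall s r ⊆ Metric.ball s ρ := Metric.closedBall_subset_ball hr.2
    have hd : DiffContOnCl ℂ f (Metric.ball s |r|) := by
      rw [abs_of_pos hr.1]
      exact (hf.mono hsub).diffContOnCl_ball subset_rfl
    have hmv := hd.circleAverage
    rw [Real.circleAverage_eq_integral_add (-π), intervalIntegral.integral_comp_add_right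
      (fun θ => f (circleMap s r θ)), show 0 + -π = -π by ring, show 2 * π + -π = π by ring,
      intervalIntegral.integral_of_le (by linarith [pi_pos]), integral_Ioc_eq_integral_Ioo] at hmv
    set ν : Measure ℝ := (ENNReal.ofReal (2 * π))⁻¹ • volume.restrict (Set.Ioo (-π) π) with hν
    have h2π : ENNReal.ofReal (2 * π) ≠ 0 := by simpa using pi_pos
    have : IsProbabilityMeasure ν := ⟨by
      simp only [hν, Measure.smul_apply, Measure.restrict_apply_univ, Real.volume_Ioo, smul_eq_mul]
      rw [show π - -π = 2 * π by ring]
      exact ENNReal.inv_mul_cancel h2π ENNReal.ofReal_ne_top⟩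
    have hm : ContinuousOn (fun θ => f (circleMap s r θ)) Set.univ :=
      (hf.continuousOn.mono hsub).comp (continuous_circleMap s r).continuousOn
        fun θ _ => circleMap_mem_closedBall s hr.1.le θ
    have hm' : Continuous (fun θ => f (circleMap s r θ)) := continuousOn_univ.1 hm
    have hJ := enorm_integral_rpow_le (ν := ν) hp hm'.aestronglyMeasurable
    rw [hν, integral_smul_measure, lintegral_smul_measure, ENNReal.toReal_inv,
      ENNReal.toReal_ofReal (by positivity), hmv, smul_eq_mul] at hJ
    calc _ ≤ ENNReal.ofReal (2 * π) * ((ENNReal.ofReal (2 * π))⁻¹ *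
        ∫⁻ θ in Set.Ioo (-π) π, ‖f (circleMap s r θ)‖ₑ ^ p) := by gcongr
      _ = ∫⁻ θ in Set.Ioo (-π) π, ‖f (circleMap s r θ)‖ₑ ^ p := by
        rw [← mul_assoc, ENNReal.mul_inv_cancel h2π ENNReal.ofReal_ne_top, one_mul]
      _ = _ := by
        simp only [Complex.polarCoord_symm_apply, circleMap, Complex.exp_mul_I,
          Complex.ofReal_cos, Complex.ofReal_sin]
  have hshift : ∫⁻ z in Metric.ball s ρ, ‖f z‖ₑ ^ p =
      ∫⁻ z, (Metric.ball s ρ).indicator (fun z => ‖f z‖ₑ ^ p) (s + z) := by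
    rw [lintegral_add_left_eq_self, lintegral_indicator Metric.isOpen_ball.measurableSet]
  have hmeas : Measurable ((Metric.ball s ρ).indicator (fun z => ‖f z‖ₑ ^ p)) := by
    classical
    rw [← Set.piecewise_eq_indicator]
    exact (ENNReal.continuous_rpow_const.comp_continuousOn
      hf.continuousOn.enorm).measurable_piecewise continuousOn_const Metric.isOpen_ball.measurableSet
  have hm2 : Measurable (fun q : ℝ × ℝ => ENNReal.ofReal q.1 •
      (Metric.ball s ρ).indicator (fun z => ‖f z‖ₑ ^ p) (s + Complex.polarCoord.symm q)) := by
    simp only [Complex.polarCoord_symm_apply]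
    refine (ENNReal.measurable_ofReal.comp measurable_fst).smul (hmeas.comp ?_)
    fun_prop
  have htar : polarCoord.target = Set.Ioi (0 : ℝ) ×ˢ Set.Ioo (-π) π := rfl
  rw [hshift, ← Complex.lintegral_comp_polarCoord_symm, htar,
    Measure.volume_eq_prod, ← Measure.prod_restrict, lintegral_prod _ hm2.aemeasurable]
  have hrad : ∫⁻ r in Set.Ioo 0 ρ, ENNReal.ofReal r = ENNReal.ofReal (ρ ^ 2 / 2) := by
    rw [← ofReal_integral_eq_lintegral_ofReal, ← integral_Ioc_eq_integral_Ioo,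
      ← intervalIntegral.integral_of_le hρ.le, integral_id]
    · simp
    · exact (continuous_id.integrableOn_Icc (a := 0) (b := ρ)).mono_set Set.Ioo_subset_Icc_self
    · filter_upwards [ae_restrict_mem measurableSet_Ioo] with r hr using hr.1.le
  calc ENNReal.ofReal (π * ρ ^ 2) * ‖f s‖ₑ ^ p
      = (∫⁻ r in Set.Ioo 0 ρ, ENNReal.ofReal r) * (ENNReal.ofReal (2 * π) * ‖f s‖ₑ ^ p) := by
        rw [hrad, ← mul_assoc, ← ENNReal.ofReal_mul (by positivity)]
        congr 2
        ring
    _ = ∫⁻ r in Set.Ioo 0 ρ, ENNReal.ofReal r * (ENNReal.ofReal (2 * π) * ‖f s‖ₑ ^ p) :=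
        (lintegral_mul_const _ ENNReal.measurable_ofReal).symm
    _ ≤ ∫⁻ r in Set.Ioo 0 ρ, ∫⁻ θ in Set.Ioo (-π) π, ENNReal.ofReal r •
          (Metric.ball s ρ).indicator (fun z => ‖f z‖ₑ ^ p)
            (s + Complex.polarCoord.symm (r, θ)) := by
        refine setLIntegral_mono' measurableSet_Ioo fun r hr => ?_
        simp only [smul_eq_mul]
        rw [lintegral_const_mul' _ _ ENNReal.ofReal_ne_top]
        gcongr
        refine (hcirc r hr).trans_eq (lintegral_congr fun θ => ?_)
        rw [Set.indicator_of_mem]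
        rw [Metric.mem_ball, dist_self_add_left, Complex.norm_polarCoord_symm, abs_of_pos hr.1]
        exact hr.2
    _ ≤ _ := lintegral_mono_set Set.Ioo_subset_Ioi_self

/-! ### The Fourier transform of the Poisson kernel -/

theorem integrable_exp_neg_mul_abs {a : ℝ} (ha : 0 < a) :
    Integrable (fun x : ℝ => (Real.exp (-a * |x|) : ℂ)) := by
  refine Integrable.ofReal (f := fun x : ℝ => Real.exp (-a * |x|)) ?_
  rw [← integrableOn_univ, ← Set.Iic_union_Ioi (a := (0 : ℝ))]
  refine IntegrableOn.union ?_ ?_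
  · refine (integrableOn_exp_mul_Iic ha 0).congr_fun (fun x hx => ?_) measurableSet_Iic
    simp only [abs_of_nonpos (Set.mem_Iic.1 hx)]
    ring_nf
  · refine (integrableOn_exp_mul_Ioi (neg_lt_zero.2 ha) 0).congr_fun (fun x hx => ?_)
      measurableSet_Ioi
    simp only [abs_of_pos (Set.mem_Ioi.1 hx)]

open Real FourierTransform in
theorem fourier_exp_neg_mul_abs {δ : ℝ≥0} (hδ : 0 < δ) (w : ℝ) :
    𝓕 (fun x : ℝ => (Real.exp (-(2 * π * δ) * |x|) : ℂ)) w
      = (ProbabilityTheory.cauchyPDFReal 0 δ w : ℂ) := by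
  have hδ' : (0 : ℝ) < δ := hδ
  have hint : Integrable (fun x : ℝ => Complex.exp (↑(-2 * π * (inner ℝ x w)) * Complex.I) •
      (Real.exp (-(2 * π * δ) * |x|) : ℂ)) := by
    refine (integrable_exp_neg_mul_abs (a := 2 * π * δ) (by positivity)).bdd_mul (c := 1)
      (Continuous.aestronglyMeasurable (by fun_prop)) (ae_of_all _ fun x => ?_)
    rw [Complex.norm_exp_ofReal_mul_I]
  rw [Real.fourier_eq', ← setIntegral_univ, ← Set.Iic_union_Ioi (a := (0 : ℝ)),
    setIntegral_union (by simp) measurableSet_Ioi hint.integrableOn hint.integrableOn]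
  have e1 : ∫ x in Set.Iic (0 : ℝ), Complex.exp (↑(-2 * π * (inner ℝ x w)) * Complex.I) •
      (Real.exp (-(2 * π * δ) * |x|) : ℂ) =
      ∫ x in Set.Iic (0 : ℝ), Complex.exp ((2 * π * δ - 2 * π * w * Complex.I) * x) := by
    refine setIntegral_congr_fun measurableSet_Iic fun x hx => ?_
    simp only [abs_of_nonpos (Set.mem_Iic.1 hx), smul_eq_mul, Complex.ofReal_exp,
      ← Complex.exp_add]
    congr 1
    simp
    ring
  have e2 : ∫ x in Set.Ioi (0 : ℝ), Complex.exp (↑(-2 * π * (inner ℝ x w)) * Complex.I) •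
      (Real.exp (-(2 * π * δ) * |x|) : ℂ) =
      ∫ x in Set.Ioi (0 : ℝ), Complex.exp ((-(2 * π * δ) - 2 * π * w * Complex.I) * x) := by
    refine setIntegral_congr_fun measurableSet_Ioi fun x hx => ?_
    simp only [abs_of_pos (Set.mem_Ioi.1 hx), smul_eq_mul, Complex.ofReal_exp,
      ← Complex.exp_add]
    congr 1
    simp
    ring
  have r1 : (2 * π * δ - 2 * π * w * Complex.I : ℂ).re = 2 * π * δ := by simp
  have r2 : (-(2 * π * δ) - 2 * π * w * Complex.I : ℂ).re = -(2 * π * δ) := by simp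
  have hpos : 0 < 2 * π * δ := by positivity
  rw [e1, e2, integral_exp_mul_complex_Iic (by rw [r1]; exact hpos),
    integral_exp_mul_complex_Ioi (by rw [r2]; linarith),
    ProbabilityTheory.cauchyPDFReal_def]
  have n1 : (δ - w * Complex.I : ℂ) ≠ 0 := fun h => by
    have := congrArg Complex.re h
    simp at this
    exact hδ.ne' this
  have n2 : (-δ - w * Complex.I : ℂ) ≠ 0 := fun h => by
    have := congrArg Complex.re h
    simp at this
    exact hδ.ne' this
  have n3 : ((w : ℂ) ^ 2 + δ ^ 2) ≠ 0 := by
    have : (0 : ℝ) < w ^ 2 + δ ^ 2 := by positivity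
    exact_mod_cast this.ne'
  have hπ : (π : ℂ) ≠ 0 := by exact_mod_cast pi_ne_zero
  have f1 : (2 * π * δ - 2 * π * w * Complex.I : ℂ) = 2 * π * (δ - w * Complex.I) := by ring
  have f2 : (-(2 * π * δ) - 2 * π * w * Complex.I : ℂ) = 2 * π * (-δ - w * Complex.I) := by ring
  rw [f1, f2]
  push_cast
  simp only [mul_zero, Complex.exp_zero, sub_zero]
  field_simp
  ring_nf
  simp only [Complex.I_sq]
  ring

open Real FourierTransform in
/-- The Cauchy distribution with scale `δ` is the Poisson kernel of a half-plane at distance `δ` from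
the boundary; its characteristic function is `exp (-δ |ξ|)`, by Fourier inversion. -/
theorem integral_cexp_cauchyMeasure {δ : ℝ≥0} (hδ : 0 < δ) {ξ : ℝ} (hξ : 0 ≤ ξ) :
    ∫ u : ℝ, Complex.exp (-(u * ξ) * Complex.I) ∂(ProbabilityTheory.cauchyMeasure 0 δ)
      = Complex.exp (-(δ * ξ)) := by
  have hδ' : (0 : ℝ) < δ := hδ
  have hf := integrable_exp_neg_mul_abs (a := 2 * π * δ) (by positivity)
  have hF : 𝓕 (fun x : ℝ => (Real.exp (-(2 * π * δ) * |x|) : ℂ))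
      = fun w => (ProbabilityTheory.cauchyPDFReal 0 δ w : ℂ) := funext (fourier_exp_neg_mul_abs hδ)
  have hFi : Integrable (𝓕 (fun x : ℝ => (Real.exp (-(2 * π * δ) * |x|) : ℂ))) := by
    rw [hF]
    exact (ProbabilityTheory.integrable_cauchyPDFReal 0).ofReal
  have hinv := hf.fourierInv_fourier_eq hFi (v := -(ξ / (2 * π)))
    (Continuous.continuousAt (by fun_prop))
  rw [hF, Real.fourierInv_eq'] at hinv
  rw [ProbabilityTheory.cauchyMeasure_of_scale_ne_zero 0 hδ.ne',
    integral_withDensity_eq_integral_toReal_smul (ProbabilityTheory.measurable_cauchyPDF 0 δ)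
      (ae_of_all _ fun _ => by simp [ProbabilityTheory.cauchyPDF_def])]
  have : Complex.exp (-(δ * ξ)) = (Real.exp (-(2 * π * δ) * |-(ξ / (2 * π))|) : ℂ) := by
    rw [abs_neg, abs_of_nonneg (by positivity)]
    push_cast
    congr 1
    have hπ : (π : ℂ) ≠ 0 := by exact_mod_cast pi_ne_zero
    field_simp
  rw [this, ← hinv]
  refine integral_congr_ae (ae_of_all _ fun u => ?_)
  simp only [ProbabilityTheory.cauchyPDF_def]
  rw [ENNReal.toReal_ofReal (ProbabilityTheory.cauchyPDF_pos 0 hδ.ne' u).le, smul_eq_mul,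
    Complex.real_smul, mul_comm]
  congr 2
  simp
  have hπ : (π : ℂ) ≠ 0 := by exact_mod_cast pi_ne_zero
  field_simp

/-! ### Dirichlet polynomials -/

theorem measurableSet_halfPlane : MeasurableSet halfPlane :=
  (isOpen_lt continuous_const Complex.continuous_re).measurableSet

theorem natCast_cpow_neg (n : ℕ+) (s : ℂ) :
    ((n : ℕ) : ℂ) ^ (-s) = Complex.exp (-(s * (Real.log (n : ℕ) : ℝ))) := by
  rw [Complex.cpow_def_of_ne_zero (by exact_mod_cast n.ne_zero), Complex.natCast_log]
  congr 1
  ring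

theorem dirichletPoly_eq_sum (a : ℕ+ →₀ ℂ) (s : ℂ) :
    dirichletPoly a s =
      ∑ n ∈ a.support, a n * Complex.exp (-(s * (Real.log (n : ℕ) : ℝ))) := by
  simp only [dirichletPoly, Finsupp.sum, natCast_cpow_neg]

theorem differentiable_dirichletPoly (a : ℕ+ →₀ ℂ) : Differentiable ℂ (dirichletPoly a) := by
  rw [show dirichletPoly a = fun s => _ from funext (dirichletPoly_eq_sum a)]
  fun_prop

theorem continuous_dirichletPoly (a : ℕ+ →₀ ℂ) : Continuous (dirichletPoly a) :=
  (differentiable_dirichletPoly a).continuous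

theorem norm_dirichletPoly_mul_I_le (a : ℕ+ →₀ ℂ) (t : ℝ) :
    ‖dirichletPoly a (t * Complex.I)‖ ≤ ∑ n ∈ a.support, ‖a n‖ := by
  rw [dirichletPoly_eq_sum]
  refine norm_sum_le_of_le _ fun n _ => ?_
  rw [norm_mul, Complex.norm_exp]
  simp [-Complex.natCast_log]

/-- The Poisson formula for Dirichlet polynomials. It holds termwise: the frequencies `log n` are
nonnegative, so `n^{-δ}` is the characteristic function of the Cauchy distribution at `log n`. -/
theorem integral_dirichletPoly_cauchyMeasure (a : ℕ+ →₀ ℂ) {δ : ℝ≥0} (hδ : 0 < δ) (s : ℂ) :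
    ∫ u : ℝ, dirichletPoly a (s + u * Complex.I) ∂(ProbabilityTheory.cauchyMeasure 0 δ)
      = dirichletPoly a (s + δ) := by
  simp only [dirichletPoly_eq_sum]
  have hfac (n : ℕ+) (u : ℝ) :
      a n * Complex.exp (-((s + u * Complex.I) * (Real.log (n : ℕ) : ℝ))) =
        a n * Complex.exp (-(s * (Real.log (n : ℕ) : ℝ))) *
          Complex.exp (-(u * (Real.log (n : ℕ) : ℝ)) * Complex.I) := by
    rw [mul_assoc, ← Complex.exp_add]
    ring_nf
  simp only [hfac]
  rw [integral_finsetSum]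
  · refine Finset.sum_congr rfl fun n _ => ?_
    rw [integral_const_mul,
      integral_cexp_cauchyMeasure hδ (Real.log_natCast_nonneg (n : ℕ)), mul_assoc,
      ← Complex.exp_add]
    ring_nf
  · intro n _
    refine Integrable.const_mul ?_ _
    refine (integrable_const (1 : ℝ)).mono' (Continuous.aestronglyMeasurable (by fun_prop))
      (ae_of_all _ fun u => ?_)
    rw [Complex.norm_exp]
    simp [-Complex.natCast_log]

/-! ### From the local embedding to Carleson measures -/

theorem setLIntegral_Ico_comp_add_right (f : ℝ → ℝ≥0∞) (x y u : ℝ) :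
    ∫⁻ t in Set.Ico x y, f (t + u) = ∫⁻ t in Set.Ico (x + u) (y + u), f t := by
  rw [← (measurePreserving_add_right volume u).setLIntegral_comp_preimage_emb
    (measurableEmbedding_addRight u) f (Set.Ico (x + u) (y + u))]
  simp

/-- A bound on unit intervals of the line `σ = 1/2` that does not depend on the position of the
interval passes to every line further right with the same constant, since by the Poisson formula
the values there are averages over vertical translates. -/
theorem setLIntegral_dirichletPoly_le_of_boundary {p : ℝ} (hp : 1 ≤ p) (a : ℕ+ →₀ ℂ) {B : ℝ≥0∞}
    (hB : ∀ x : ℝ, ∫⁻ t in Set.Ico x (x + 1),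
      ‖dirichletPoly a (1 / 2 + t * Complex.I)‖ₑ ^ p ≤ B)
    {σ : ℝ} (hσ : 1 / 2 < σ) (x : ℝ) :
    ∫⁻ t in Set.Ico x (x + 1), ‖dirichletPoly a (σ + t * Complex.I)‖ₑ ^ p ≤ B := by
  set δ : ℝ≥0 := ⟨σ - 1 / 2, by linarith⟩ with hδ
  have hδ0 : 0 < δ := by
    rw [← NNReal.coe_pos]
    change 0 < σ - 1 / 2
    linarith
  have hσδ : (σ : ℂ) = 1 / 2 + ((δ : ℝ) : ℂ) := by
    change (σ : ℂ) = 1 / 2 + ((σ - 1 / 2 : ℝ) : ℂ)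
    push_cast
    ring
  set ν := ProbabilityTheory.cauchyMeasure 0 δ
  have hc := continuous_dirichletPoly a
  set h : ℝ → ℝ≥0∞ := fun t => ‖dirichletPoly a (1 / 2 + t * Complex.I)‖ₑ ^ p with hh
  have hhm : Measurable h := by
    refine Measurable.pow_const (Continuous.measurable ?_) _
    fun_prop
  have hpt (t : ℝ) : ‖dirichletPoly a (σ + t * Complex.I)‖ₑ ^ p ≤ ∫⁻ u, h (t + u) ∂ν := by
    have e : dirichletPoly a (σ + t * Complex.I) =
        ∫ u : ℝ, dirichletPoly a (1 / 2 + t * Complex.I + u * Complex.I) ∂ν := by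
      rw [integral_dirichletPoly_cauchyMeasure a hδ0, hσδ]
      ring_nf
    rw [e]
    refine (enorm_integral_rpow_le hp
      (Continuous.aestronglyMeasurable (by fun_prop))).trans_eq ?_
    refine lintegral_congr fun u => ?_
    simp only [hh]
    push_cast
    ring_nf
  calc ∫⁻ t in Set.Ico x (x + 1), ‖dirichletPoly a (σ + t * Complex.I)‖ₑ ^ p
      ≤ ∫⁻ t in Set.Ico x (x + 1), ∫⁻ u, h (t + u) ∂ν := lintegral_mono hpt
    _ = ∫⁻ u, (∫⁻ t in Set.Ico x (x + 1), h (t + u)) ∂ν :=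
        lintegral_lintegral_swap (hhm.comp (measurable_fst.add measurable_snd)).aemeasurable
    _ ≤ ∫⁻ _, B ∂ν := by
        refine lintegral_mono fun u => ?_
        rw [setLIntegral_Ico_comp_add_right]
        convert hB (x + u) using 4
        ring
    _ = B := by simp

theorem one_add_sq_le_of_mem_Ico {x t : ℝ} (ht : t ∈ Set.Ico x (x + 1)) :
    1 + x ^ 2 ≤ 3 * (1 + t ^ 2) ∧ 1 + t ^ 2 ≤ 3 * (1 + x ^ 2) := by
  obtain ⟨h1, h2⟩ := ht
  constructor <;> nlinarith [sq_nonneg (t + x), sq_nonneg (2 * t - x), sq_nonneg (2 * x - t)]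

/-- A bound that is uniform over unit intervals gives one for the integral against the
integrable weight `1 / (1 + t²)`, whose values vary by at most a factor `3` on such an interval. -/
theorem lintegral_mul_weight_le {h : ℝ → ℝ≥0∞} {B : ℝ≥0∞}
    (hB : ∀ x : ℝ, ∫⁻ t in Set.Ico x (x + 1), h t ≤ B) :
    ∫⁻ t, ENNReal.ofReal (1 + t ^ 2)⁻¹ * h t ≤ ENNReal.ofReal (9 * Real.pi) * B := by
  have hsplit (g : ℝ → ℝ≥0∞) : ∫⁻ t, g t = ∑' k : ℤ, ∫⁻ t in Set.Ico (k : ℝ) (k + 1), g t := by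
    rw [← lintegral_iUnion (fun _ => measurableSet_Ico) (Set.pairwise_disjoint_Ico_intCast ℝ),
      iUnion_Ico_intCast, setLIntegral_univ]
  have hW : ∫⁻ t : ℝ, ENNReal.ofReal (9 * (1 + t ^ 2)⁻¹) = ENNReal.ofReal (9 * Real.pi) := by
    rw [← ofReal_integral_eq_lintegral_ofReal (integrable_inv_one_add_sq.const_mul 9)
      (ae_of_all _ fun t => by positivity), integral_const_mul, integral_univ_inv_one_add_sq]
  rw [← hW, hsplit, hsplit (fun t => ENNReal.ofReal (9 * (1 + t ^ 2)⁻¹)), ← ENNReal.tsum_mul_right]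
  refine ENNReal.tsum_le_tsum fun k => ?_
  have hk : ENNReal.ofReal (3 * (1 + (k : ℝ) ^ 2)⁻¹) ≤
      ∫⁻ t in Set.Ico (k : ℝ) (k + 1), ENNReal.ofReal (9 * (1 + t ^ 2)⁻¹) := by
    calc ENNReal.ofReal (3 * (1 + (k : ℝ) ^ 2)⁻¹)
        = ∫⁻ t in Set.Ico (k : ℝ) (k + 1), ENNReal.ofReal (3 * (1 + (k : ℝ) ^ 2)⁻¹) := by simp
      _ ≤ _ := by
        refine setLIntegral_mono' measurableSet_Ico fun t ht => ENNReal.ofReal_le_ofReal ?_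
        have := (one_add_sq_le_of_mem_Ico ht).2
        rw [← div_eq_mul_inv, ← div_eq_mul_inv, div_le_div_iff₀ (by positivity) (by positivity)]
        linarith
  calc ∫⁻ t in Set.Ico (k : ℝ) (k + 1), ENNReal.ofReal (1 + t ^ 2)⁻¹ * h t
      ≤ ∫⁻ t in Set.Ico (k : ℝ) (k + 1), ENNReal.ofReal (3 * (1 + (k : ℝ) ^ 2)⁻¹) * h t := by
        refine setLIntegral_mono' measurableSet_Ico fun t ht => ?_
        gcongr
        have := (one_add_sq_le_of_mem_Ico ht).1
        rw [← div_eq_mul_inv, ← one_div, div_le_div_iff₀ (by positivity) (by positivity)]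
        linarith
    _ = ENNReal.ofReal (3 * (1 + (k : ℝ) ^ 2)⁻¹) * ∫⁻ t in Set.Ico (k : ℝ) (k + 1), h t :=
        lintegral_const_mul' _ _ ENNReal.ofReal_ne_top
    _ ≤ _ := by gcongr; exact hB k

/-- The function `(s + 1/2)⁻²`, holomorphic and zero-free on the half-plane. Multiplication by it
turns Dirichlet polynomials into members of `H^p`: its square decay makes its `p`-th power integrable
on vertical lines for every `p ≥ 1`. -/
def damping (s : ℂ) : ℂ := ((s + 1 / 2) ^ 2)⁻¹

theorem enorm_damping_rpow_le {p : ℝ} (hp : 1 ≤ p) {σ : ℝ} (hσ : 1 / 2 < σ) (t : ℝ) :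
    ‖damping (σ + t * Complex.I)‖ₑ ^ p ≤ ENNReal.ofReal (1 + t ^ 2)⁻¹ := by
  have hn : ‖((σ + t * Complex.I + 1 / 2) ^ 2 : ℂ)‖ = (σ + 1 / 2) ^ 2 + t ^ 2 := by
    rw [norm_pow, ← Complex.normSq_eq_norm_sq, Complex.normSq_apply]
    simp
    ring
  have h1 : 1 + t ^ 2 ≤ (σ + 1 / 2) ^ 2 + t ^ 2 := by nlinarith
  have h2 : ‖damping (σ + t * Complex.I)‖ₑ ≤ ENNReal.ofReal (1 + t ^ 2)⁻¹ := by
    rw [← ofReal_norm, damping, norm_inv, hn]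
    exact ENNReal.ofReal_le_ofReal (inv_anti₀ (by positivity) h1)
  have h3 : ENNReal.ofReal (1 + t ^ 2)⁻¹ ≤ 1 := by
    rw [ENNReal.ofReal_le_one]
    exact inv_le_one_of_one_le₀ (by nlinarith [sq_nonneg t])
  calc _ ≤ ENNReal.ofReal (1 + t ^ 2)⁻¹ ^ p := by gcongr
    _ ≤ _ := ENNReal.rpow_le_self_of_le_one h3 hp

theorem add_half_ne_zero {s : ℂ} (hs : s ∈ halfPlane) : s + 1 / 2 ≠ 0 := fun h => by
  have h1 := congrArg Complex.re h
  have h2 : 1 / 2 < s.re := hs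
  norm_num at h1
  linarith

theorem differentiableOn_damping : DifferentiableOn ℂ damping halfPlane := by
  intro s hs
  have := add_half_ne_zero hs
  refine DifferentiableAt.differentiableWithinAt ?_
  unfold damping
  exact DifferentiableAt.inv (by fun_prop) (pow_ne_zero 2 this)

theorem hardyNorm_rpow_le {p : ℝ} (hp : 0 < p) {f : ℂ → ℂ} {B : ℝ≥0∞}
    (h : ∀ σ : ℝ, 1 / 2 < σ → ∫⁻ t : ℝ, ‖f (σ + t * Complex.I)‖ₑ ^ p ≤ B) :
    hardyNorm p f ^ p ≤ B := by
  have : hardyNorm p f ≤ B ^ (1 / p) := iSup₂_le fun σ hσ => by gcongr; exact h σ hσ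
  calc _ ≤ (B ^ (1 / p)) ^ p := by gcongr
    _ = B := by rw [← ENNReal.rpow_mul, one_div_mul_cancel hp.ne', ENNReal.rpow_one]

theorem lintegral_vertical_le_hardyNorm {p : ℝ} (hp : 0 < p) (f : ℂ → ℂ) {σ : ℝ}
    (hσ : 1 / 2 < σ) : ∫⁻ t : ℝ, ‖f (σ + t * Complex.I)‖ₑ ^ p ≤ hardyNorm p f ^ p := by
  have : (∫⁻ t : ℝ, ‖f (σ + t * Complex.I)‖ₑ ^ p) ^ (1 / p) ≤ hardyNorm p f :=
    le_iSup₂ (f := fun (σ : ℝ) (_ : 1 / 2 < σ) =>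
      (∫⁻ t : ℝ, ‖f (σ + t * Complex.I)‖ₑ ^ p) ^ (1 / p)) σ hσ
  calc _ = ((∫⁻ t : ℝ, ‖f (σ + t * Complex.I)‖ₑ ^ p) ^ (1 / p)) ^ p := by
        rw [← ENNReal.rpow_mul, one_div_mul_cancel hp.ne', ENNReal.rpow_one]
    _ ≤ _ := by gcongr

/-- A Carleson inequality for Dirichlet polynomials extends to all of `𝓗^p`, by Fatou's lemma. As
`K > 0`, the right-hand side is `∞` when the infimum in the norm of `F` runs over the empty set, so the
existence of an approximating sequence with convergent norms need not be checked. -/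
theorem dirichletHardyCarlesonBound_of_dirichletPoly {p : ℝ} (hp : 0 < p) {μ : Measure ℂ}
    {K : ℝ≥0} (hK : 0 < K)
    (h : ∀ a : ℕ+ →₀ ℂ, ∫⁻ s in halfPlane, ‖dirichletPoly a s‖ₑ ^ p ∂μ ≤ K * polyNorm p a ^ p) :
    DirichletHardyCarlesonBound p μ K := by
  intro F _
  have hK0 : (K : ℝ≥0∞) ≠ 0 := by simpa using hK.ne'
  have key : ((∫⁻ s in halfPlane, ‖F s‖ₑ ^ p ∂μ) / K) ^ (1 / p) ≤ dirichletHardyNorm p F := by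
    refine le_sInf ?_
    rintro N ⟨P, hP, hN⟩
    have hlim : ∫⁻ s in halfPlane, ‖F s‖ₑ ^ p ∂μ ≤ K * N ^ p := by
      calc ∫⁻ s in halfPlane, ‖F s‖ₑ ^ p ∂μ
          = ∫⁻ s in halfPlane, liminf (fun k => ‖dirichletPoly (P k) s‖ₑ ^ p) atTop ∂μ := by
            refine setLIntegral_congr_fun measurableSet_halfPlane fun s hs => ?_
            exact (((ENNReal.continuous_rpow_const).tendsto _).comp
              ((hP.tendsto s hs).enorm)).liminf_eq.symm
        _ ≤ liminf (fun k => ∫⁻ s in halfPlane, ‖dirichletPoly (P k) s‖ₑ ^ p ∂μ) atTop :=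
            lintegral_liminf_le fun k =>
              (continuous_dirichletPoly (P k)).enorm.measurable.pow_const _
        _ ≤ liminf (fun k => K * polyNorm p (P k) ^ p) atTop :=
            liminf_le_liminf (Eventually.of_forall fun k => h (P k))
        _ = K * N ^ p := by
            refine Tendsto.liminf_eq ?_
            exact ENNReal.Tendsto.const_mul
              (((ENNReal.continuous_rpow_const).tendsto _).comp hN) (Or.inr ENNReal.coe_ne_top)
    calc _ ≤ (N ^ p) ^ (1 / p) := by
          gcongr
          exact ENNReal.div_le_of_le_mul' hlim
      _ = N := by rw [← ENNReal.rpow_mul, mul_one_div_cancel hp.ne', ENNReal.rpow_one]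
  calc ∫⁻ s in halfPlane, ‖F s‖ₑ ^ p ∂μ
      = K * (((∫⁻ s in halfPlane, ‖F s‖ₑ ^ p ∂μ) / K) ^ (1 / p)) ^ p := by
        rw [← ENNReal.rpow_mul, one_div_mul_cancel hp.ne', ENNReal.rpow_one,
          ENNReal.mul_div_cancel hK0 ENNReal.coe_ne_top]
    _ ≤ _ := by gcongr

/-- If the embedding holds uniformly on unit intervals of the line `σ = 1/2`, then local Carleson
measures for `H^p` are Carleson for `𝓗^p`. -/
theorem isDirichletHardyCarleson_of_local {p : ℝ} (hp : 1 ≤ p) {C₁ : ℝ≥0} (hC₁ : 0 < C₁)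
    (hloc : ∀ (a : ℕ+ →₀ ℂ) (x : ℝ), ∫⁻ t in Set.Ico x (x + 1),
      ‖dirichletPoly a (1 / 2 + t * Complex.I)‖ₑ ^ p ≤ C₁ * polyNorm p a ^ p)
    {μ : Measure ℂ} (hμ : IsLocalMeasure μ) (hC : IsHardyCarleson p μ) :
    IsDirichletHardyCarleson p μ := by
  have hp0 : 0 < p := by linarith
  obtain ⟨C, hC0, hC⟩ := hC
  obtain ⟨R, hR⟩ := hμ.2.exists_norm_le
  set R' : ℝ := (max R 0 + 1) ^ 2
  have hR' : 0 < R' := by positivity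
  set M : ℝ≥0 := Real.toNNReal (R' ^ p)
  have hM : 0 < M := by
    simp only [M, Real.toNNReal_pos]
    positivity
  -- the damping factor is bounded below on the support of the measure
  have hbelow : ∀ᵐ s ∂(μ.restrict halfPlane), ∀ z : ℂ,
      ‖z‖ₑ ^ p ≤ M * ‖z * damping s‖ₑ ^ p := by
    filter_upwards [ae_restrict_mem measurableSet_halfPlane,
      ae_restrict_of_ae Measure.support_mem_ae] with s hs hsupp z
    have hb : ‖s + 1 / 2‖ ^ 2 ≤ R' := by
      have : ‖s + 1 / 2‖ ≤ max R 0 + 1 := by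
        refine (norm_add_le _ _).trans ?_
        have := hR s hsupp
        have := le_max_left R 0
        norm_num
        linarith
      simp only [R']
      gcongr
    have h1 : z = (z * damping s) * (s + 1 / 2) ^ 2 := by
      rw [damping, mul_assoc, inv_mul_cancel₀ (pow_ne_zero 2 (add_half_ne_zero hs)), mul_one]
    have h2 : ‖(s + 1 / 2) ^ 2‖ₑ ^ p ≤ M := by
      rw [← ofReal_norm, ENNReal.ofReal_rpow_of_nonneg (norm_nonneg _) hp0.le, norm_pow]
      exact ENNReal.ofReal_le_ofReal (by gcongr)
    conv_lhs => rw [h1]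
    rw [enorm_mul, ENNReal.mul_rpow_of_nonneg _ _ hp0.le, mul_comm]
    gcongr
  set K : ℝ≥0 := Real.toNNReal (9 * Real.pi) * C₁
  have hK : 0 < K := mul_pos (by simp [Real.pi_pos]) hC₁
  refine ⟨M * C * K, by positivity, ?_⟩
  refine dirichletHardyCarlesonBound_of_dirichletPoly hp0 (by positivity) fun a => ?_
  rcases eq_or_ne (polyNorm p a) ∞ with htop | htop
  · rw [htop, ENNReal.top_rpow_of_pos hp0, ENNReal.mul_top (by
      simpa using ⟨⟨hM.ne', hC0.ne'⟩, hK.ne'⟩)]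
    exact le_top
  have hHardy : hardyNorm p (fun s => dirichletPoly a s * damping s) ^ p ≤
      K * polyNorm p a ^ p := by
    refine hardyNorm_rpow_le hp0 fun σ hσ => ?_
    calc ∫⁻ t : ℝ, ‖dirichletPoly a (σ + t * Complex.I) * damping (σ + t * Complex.I)‖ₑ ^ p
        ≤ ∫⁻ t : ℝ, ENNReal.ofReal (1 + t ^ 2)⁻¹ *
            ‖dirichletPoly a (σ + t * Complex.I)‖ₑ ^ p := by
          refine lintegral_mono fun t => ?_
          rw [enorm_mul, ENNReal.mul_rpow_of_nonneg _ _ hp0.le, mul_comm]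
          gcongr
          exact enorm_damping_rpow_le hp hσ t
      _ ≤ ENNReal.ofReal (9 * Real.pi) * (C₁ * polyNorm p a ^ p) :=
          lintegral_mul_weight_le
            (setLIntegral_dirichletPoly_le_of_boundary hp a (hloc a) hσ)
      _ = _ := by
          simp only [K, ENNReal.coe_mul, mul_assoc]
          rfl
  have hmem : MemHardy p (fun s => dirichletPoly a s * damping s) := by
    refine ⟨(differentiable_dirichletPoly a).differentiableOn.mul differentiableOn_damping, ?_⟩
    rw [← ENNReal.rpow_lt_top_iff_of_pos hp0]
    exact hHardy.trans_lt (ENNReal.mul_lt_top ENNReal.coe_lt_top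
      (ENNReal.rpow_lt_top_of_nonneg hp0.le htop))
  calc ∫⁻ s in halfPlane, ‖dirichletPoly a s‖ₑ ^ p ∂μ
      ≤ ∫⁻ s in halfPlane, M * ‖dirichletPoly a s * damping s‖ₑ ^ p ∂μ :=
        lintegral_mono_ae (hbelow.mono fun s hs => hs _)
    _ = M * ∫⁻ s in halfPlane, ‖dirichletPoly a s * damping s‖ₑ ^ p ∂μ :=
        lintegral_const_mul' _ _ ENNReal.coe_ne_top
    _ ≤ M * (C * (K * polyNorm p a ^ p)) := by
        gcongr
        exact (hC _ hmem).trans (by gcongr)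
    _ = _ := by
        push_cast
        ring

/-! ### Uniformity of the Carleson constant over discrete measures -/

theorem discreteMeasure_eq_zero {ι : Type} {s : ι → ℂ} {A : Set ℂ} (hA : MeasurableSet A)
    (h : ∀ n, s n ∉ A) : discreteMeasure s A = 0 := by
  simp [discreteMeasure, Measure.sum_apply _ hA, Measure.dirac_apply' _ hA, h]

theorem setLIntegral_discreteMeasure {ι : Type} {s : ι → ℂ} (hs : ∀ n, s n ∈ halfPlane)
    (g : ℂ → ℝ≥0∞) :
    ∫⁻ z in halfPlane, g z ∂(discreteMeasure s) =
      ∑' n, ENNReal.ofReal (2 * (s n).re - 1) * g (s n) := by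
  have : ∀ᵐ z ∂(discreteMeasure s), z ∈ halfPlane :=
    discreteMeasure_eq_zero measurableSet_halfPlane.compl fun n => by simpa using hs n
  rw [Measure.restrict_eq_self_of_ae_mem this, discreteMeasure, lintegral_sum_measure]
  simp

/-- If local Carleson measures for `H^p` are Carleson for `𝓗^p`, then the constants are comparable,
uniformly over the discrete measures on a bounded set. Otherwise, a normalized sum of discrete
measures whose ratios of constants exceed `4^k` is a local Carleson measure for `H^p` that is not
Carleson for `𝓗^p`. -/
theorem exists_uniform_bound_of_forall_local {p : ℝ}
    (hb : ∀ μ : Measure ℂ, IsLocalMeasure μ → IsHardyCarleson p μ → IsDirichletHardyCarleson p μ)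
    {Γ : Set ℂ} (hΓ : Γ ⊆ halfPlane) (hbd : Bornology.IsBounded Γ) :
    ∃ D : ℝ≥0, 0 < D ∧
      ∀ (ι : Type) [Countable ι] (s : ι → ℂ), (∀ n, s n ∈ Γ) →
        ∀ C : ℝ≥0, 0 < C → HardyCarlesonBound p (discreteMeasure s) C →
          DirichletHardyCarlesonBound p (discreteMeasure s) (C * D) := by
  by_contra! h
  choose ι hι s hs C hC hH hD using fun k : ℕ => h (4 ^ k) (by positivity)
  -- with these weights, the `k`-th summand has Carleson constant `2^{-k}` for `H^p`
  set c : ℕ → ℝ≥0 := fun k => (2 ^ k * C k)⁻¹ with hc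
  have hc0 (k : ℕ) : 0 < c k := by have := hC k; positivity
  have hcC (k : ℕ) : c k * C k = 2⁻¹ ^ k := by
    have := (hC k).ne'
    simp only [hc]
    field_simp
    simp
  set μ : Measure ℂ := Measure.sum fun k => (c k : ℝ≥0∞) • discreteMeasure (s k) with hμ
  have hint (g : ℂ → ℝ≥0∞) : ∫⁻ z in halfPlane, g z ∂μ =
      ∑' k, (c k : ℝ≥0∞) * ∫⁻ z in halfPlane, g z ∂(discreteMeasure (s k)) := by
    rw [hμ, Measure.restrict_sum _ measurableSet_halfPlane, lintegral_sum_measure]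
    simp only [Measure.restrict_smul, lintegral_smul_measure, smul_eq_mul]
  have hzero {A : Set ℂ} (hA : MeasurableSet A) (hΓA : ∀ z ∈ Γ, z ∉ A) : μ A = 0 := by
    rw [hμ, Measure.sum_apply _ hA]
    simp [discreteMeasure_eq_zero hA fun n => hΓA _ (hs _ n)]
  have hloc : IsLocalMeasure μ := by
    refine ⟨hzero measurableSet_halfPlane.compl fun z hz => by simpa using hΓ hz, ?_⟩
    refine hbd.closure.subset (Measure.support_subset_of_isClosed isClosed_closure ?_)
    exact hzero isClosed_closure.measurableSet.compl fun z hz => by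
      simpa using subset_closure hz
  have hcar : IsHardyCarleson p μ := by
    refine ⟨2, by norm_num, fun f hf => ?_⟩
    rw [hint]
    calc _ ≤ ∑' k, ((2⁻¹ : ℝ≥0∞) ^ k) * hardyNorm p f ^ p := by
          refine ENNReal.tsum_le_tsum fun k => ?_
          calc _ ≤ (c k : ℝ≥0∞) * (C k * hardyNorm p f ^ p) := by gcongr; exact hH k f hf
            _ = _ := by
              rw [← mul_assoc, ← ENNReal.coe_mul, hcC]
              simp [ENNReal.inv_pow]
      _ = _ := by
          rw [ENNReal.tsum_mul_right, ENNReal.tsum_geometric, ENNReal.one_sub_inv_two, inv_inv]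
          rfl
  obtain ⟨C', -, hC'⟩ := hb μ hloc hcar
  obtain ⟨k, hk⟩ := pow_unbounded_of_one_lt C' (one_lt_two : (1 : ℝ≥0) < 2)
  refine hD k fun F hF => ?_
  have h1 := (hint _ ▸ hC' F hF)
  have h2 := (ENNReal.le_tsum k).trans h1
  have hck : (c k : ℝ≥0∞) ≠ 0 := by simpa using (hc0 k).ne'
  calc _ = (c k : ℝ≥0∞)⁻¹ * (c k * ∫⁻ z in halfPlane, ‖F z‖ₑ ^ p ∂(discreteMeasure (s k))) := by
        rw [← mul_assoc, ENNReal.inv_mul_cancel hck ENNReal.coe_ne_top, one_mul]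
    _ ≤ (c k : ℝ≥0∞)⁻¹ * (2 ^ k * dirichletHardyNorm p F ^ p) := by
        refine mul_le_mul' le_rfl (h2.trans (mul_le_mul' ?_ le_rfl))
        exact_mod_cast hk.le
    _ = _ := by
        rw [← ENNReal.coe_inv (hc0 k).ne', ← mul_assoc]
        simp only [hc, inv_inv]
        push_cast
        rw [show (4 : ℝ≥0∞) = 2 * 2 by norm_num, mul_pow]
        ring

/-! ### Dirichlet polynomials in `𝓗^p` and their vertical translates -/

theorem polyNorm_zero {p : ℝ} (hp : 0 < p) : polyNorm p 0 = 0 := by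
  simp [polyNorm, dirichletPoly, hp]

theorem approximates_dirichletPoly {p : ℝ} (hp : 0 < p) (a : ℕ+ →₀ ℂ) :
    Approximates p (fun _ => a) (dirichletPoly a) where
  cauchy _ _ := ⟨0, fun _ _ _ _ => by simp [polyNorm_zero hp]⟩
  tendsto _ _ := tendsto_const_nhds

theorem dirichletHardyNorm_dirichletPoly_le {p : ℝ} (hp : 0 < p) (a : ℕ+ →₀ ℂ) :
    dirichletHardyNorm p (dirichletPoly a) ≤ polyNorm p a :=
  sInf_le ⟨fun _ => a, approximates_dirichletPoly hp a, tendsto_const_nhds⟩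

/-- The coefficients `a_n n^{-iτ}` of the vertical translate `s ↦ ∑ a_n n^{-(s + iτ)}`. -/
def verticalShift (τ : ℝ) (a : ℕ+ →₀ ℂ) : ℕ+ →₀ ℂ :=
  Finsupp.onFinset a.support
    (fun n => a n * Complex.exp (-(τ * Complex.I * (Real.log (n : ℕ) : ℝ))))
    fun _ hn => Finsupp.mem_support_iff.2 (left_ne_zero_of_mul hn)

theorem dirichletPoly_verticalShift (τ : ℝ) (a : ℕ+ →₀ ℂ) (s : ℂ) :
    dirichletPoly (verticalShift τ a) s = dirichletPoly a (s + τ * Complex.I) := by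
  rw [dirichletPoly_eq_sum a, dirichletPoly, verticalShift,
    Finsupp.onFinset_sum _ (fun _ => zero_mul _)]
  refine Finset.sum_congr rfl fun n _ => ?_
  rw [natCast_cpow_neg, mul_assoc, ← Complex.exp_add]
  ring_nf

/-- Translation invariance of the mean value: Dirichlet polynomials are bounded on the imaginary
axis, so moving the window `[-T, T]` by `τ` changes the integral by an amount bounded in `T`. -/
theorem polyNorm_verticalShift_le {p : ℝ} (hp : 1 ≤ p) (τ : ℝ) (a : ℕ+ →₀ ℂ) :
    polyNorm p (verticalShift τ a) ≤ polyNorm p a := by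
  have hp0 : 0 < p := by linarith
  set h : ℝ → ℝ≥0∞ := fun t => ‖dirichletPoly a (t * Complex.I)‖ₑ ^ p with hh
  set M : ℝ≥0∞ := ENNReal.ofReal (∑ n ∈ a.support, ‖a n‖) ^ p with hM
  have hMtop : M ≠ ∞ := ENNReal.rpow_ne_top_of_nonneg hp0.le ENNReal.ofReal_ne_top
  have hhM (t : ℝ) : h t ≤ M := by
    simp only [hh, hM, ← ofReal_norm]
    gcongr
    exact norm_dirichletPoly_mul_I_le a t
  -- the contribution to the norm of the two end pieces of length `|τ|`
  set v : ℝ → ℝ≥0∞ := fun T =>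
    (ENNReal.ofReal (1 / (2 * T)) * (2 * (M * ENNReal.ofReal |τ|))) ^ (1 / p) with hv
  have hv0 : Tendsto v atTop (𝓝 0) := by
    have h1 : Tendsto (fun T : ℝ => 1 / (2 * T)) atTop (𝓝 0) :=
      tendsto_const_nhds.div_atTop (tendsto_id.const_mul_atTop two_pos)
    have h2 := ENNReal.Tendsto.mul_const (b := 2 * (M * ENNReal.ofReal |τ|))
      (ENNReal.tendsto_ofReal h1) (Or.inr (by finiteness))
    have h3 := ((ENNReal.continuous_rpow_const (y := 1 / p)).tendsto _).comp h2
    simpa [hv, Function.comp_def, hp0] using h3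
  have hshift (T : ℝ) : ∫⁻ t in Set.Icc (-T) T, ‖dirichletPoly (verticalShift τ a)
      (t * Complex.I)‖ₑ ^ p ≤ (∫⁻ t in Set.Icc (-T) T, h t) + 2 * (M * ENNReal.ofReal |τ|) := by
    have hset (x y : ℝ) : ∫⁻ t in Set.Icc x y, h t ≤ M * ENNReal.ofReal (y - x) := by
      refine (setLIntegral_mono' measurableSet_Icc fun t _ => hhM t).trans_eq ?_
      simp
    calc ∫⁻ t in Set.Icc (-T) T, ‖dirichletPoly (verticalShift τ a) (t * Complex.I)‖ₑ ^ p
        = ∫⁻ t in Set.Icc (-T) T, h (t + τ) := by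
          simp only [dirichletPoly_verticalShift, hh]
          push_cast
          simp only [add_mul]
      _ = ∫⁻ t in Set.Icc (-T + τ) (T + τ), h t := by
          rw [← (measurePreserving_add_right volume τ).setLIntegral_comp_preimage_emb
            (measurableEmbedding_addRight τ) h (Set.Icc (-T + τ) (T + τ))]
          simp
      _ ≤ ∫⁻ t in Set.Icc (-T) T ∪ (Set.Icc (-T - |τ|) (-T) ∪ Set.Icc T (T + |τ|)), h t := by
          refine lintegral_mono_set fun t ht => ?_
          have := neg_abs_le τ
          have := le_abs_self τ
          simp only [Set.mem_union, Set.mem_Icc] at ht ⊢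
          grind
      _ ≤ (∫⁻ t in Set.Icc (-T) T, h t) +
            (M * ENNReal.ofReal |τ| + M * ENNReal.ofReal |τ|) := by
          refine (lintegral_union_le _ _ _).trans ?_
          gcongr
          refine (lintegral_union_le _ _ _).trans ?_
          gcongr
          · simpa using hset (-T - |τ|) (-T)
          · simpa using hset T (T + |τ|)
      _ = _ := by rw [two_mul]
  refine ENNReal.le_of_forall_pos_le_add fun ε hε _ => ?_
  calc polyNorm p (verticalShift τ a)
      ≤ limsup (fun T : ℝ => (ENNReal.ofReal (1 / (2 * T)) *
          ∫⁻ t in Set.Icc (-T) T, h t) ^ (1 / p) + ε) atTop := by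
        refine limsup_le_limsup ?_
        filter_upwards [hv0.eventually_le_const (by exact_mod_cast hε : (0 : ℝ≥0∞) < ε)] with T hT
        calc _ ≤ (ENNReal.ofReal (1 / (2 * T)) *
              ((∫⁻ t in Set.Icc (-T) T, h t) + 2 * (M * ENNReal.ofReal |τ|))) ^ (1 / p) :=
              ENNReal.rpow_le_rpow (mul_le_mul' le_rfl (hshift T)) (by positivity)
          _ ≤ (ENNReal.ofReal (1 / (2 * T)) * ∫⁻ t in Set.Icc (-T) T, h t) ^ (1 / p) + v T := by
              rw [mul_add]
              exact ENNReal.rpow_add_le_add_rpow _ _ (by positivity)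
                ((div_le_one hp0).2 hp)
          _ ≤ _ := add_le_add le_rfl hT
    _ = polyNorm p a + ε :=
        limsup_add_const atTop _ _ (by isBoundedDefault) (by isBoundedDefault)

/-! ### From discrete measures to the local embedding -/

theorem setLIntegral_re_mem_le (g : ℂ → ℝ≥0∞) (J : Set ℝ) :
    ∫⁻ z in {z : ℂ | z.re ∈ J}, g z ≤ ∫⁻ σ in J, ∫⁻ t : ℝ, g (σ + t * Complex.I) := by
  rw [← (Complex.volume_preserving_equiv_real_prod.symm).setLIntegral_comp_preimage_emb
    Complex.measurableEquivRealProd.symm.measurableEmbedding]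
  have : (Complex.measurableEquivRealProd.symm ⁻¹' {z : ℂ | z.re ∈ J}) = J ×ˢ Set.univ := by
    ext z
    simp
  rw [this, Measure.volume_eq_prod, ← Measure.prod_restrict, Measure.restrict_univ]
  refine (lintegral_prod_le _).trans_eq ?_
  refine lintegral_congr fun σ => lintegral_congr fun t => ?_
  congr 1
  apply Complex.ext <;> simp

/-- Points on the line `σ = 1/2 + ε` at mutual distance at least `ε` give a Carleson measure for
`H^p` with a constant that does not depend on `ε`: the discs of radius `ε/2` about them are disjoint
and lie in a strip of width `ε` inside the half-plane. -/
theorem hardyCarlesonBound_of_separated {p : ℝ} (hp : 1 ≤ p) {ι : Type} [Countable ι]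
    {t : ι → ℝ} {ε : ℝ} (hε : 0 < ε) (hsep : ∀ i j, i ≠ j → ε ≤ |t i - t j|) :
    HardyCarlesonBound p
      (discreteMeasure fun n => ((1 / 2 + ε : ℝ) : ℂ) + t n * Complex.I) 8 := by
  intro f hf
  have hp0 : 0 < p := by linarith
  set s : ι → ℂ := fun n => ((1 / 2 + ε : ℝ) : ℂ) + t n * Complex.I with hs
  have hre (n : ι) : (s n).re = 1 / 2 + ε := by simp [hs]
  have him (n : ι) : (s n).im = t n := by simp [hs]
  have hmem (n : ι) : s n ∈ halfPlane := by
    change 1 / 2 < (s n).re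
    rw [hre]
    linarith
  set J : Set ℝ := Set.Ioo (1 / 2 + ε / 2) (1 / 2 + 3 * ε / 2)
  have hball (n : ι) : Metric.ball (s n) (ε / 2) ⊆ {z : ℂ | z.re ∈ J} := by
    intro z hz
    have h1 : |(z - s n).re| < ε / 2 :=
      (Complex.abs_re_le_norm _).trans_lt (by simpa [dist_eq_norm] using hz)
    rw [Complex.sub_re, hre, abs_lt] at h1
    constructor <;> linarith [h1.1, h1.2]
  have hJ : {z : ℂ | z.re ∈ J} ⊆ halfPlane := fun z hz => by
    have : 1 / 2 + ε / 2 < z.re := hz.1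
    change 1 / 2 < z.re
    linarith
  have hdisj : Pairwise (Function.onFun Disjoint fun n => Metric.ball (s n) (ε / 2)) := by
    intro i j hij
    refine Metric.ball_disjoint_ball ?_
    calc ε / 2 + ε / 2 = ε := by ring
      _ ≤ |(s i - s j).im| := by
        rw [Complex.sub_im, him, him]
        exact hsep i j hij
      _ ≤ dist (s i) (s j) := by
        rw [dist_eq_norm]
        exact Complex.abs_im_le_norm _
  -- the weight `2ε` is at most `8 / ε` times the area `π (ε / 2) ^ 2` of the disc
  have hpt (n : ι) : ENNReal.ofReal (2 * (s n).re - 1) * ‖f (s n)‖ₑ ^ p ≤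
      ENNReal.ofReal (8 / ε) * ∫⁻ z in Metric.ball (s n) (ε / 2), ‖f z‖ₑ ^ p := by
    calc _ ≤ ENNReal.ofReal (8 / ε) * (ENNReal.ofReal (Real.pi * (ε / 2) ^ 2) * ‖f (s n)‖ₑ ^ p) := by
          rw [← mul_assoc, ← ENNReal.ofReal_mul (by positivity), hre]
          gcongr
          have : 8 / ε * (Real.pi * (ε / 2) ^ 2) = 2 * ε * Real.pi := by
            field_simp
            ring
          rw [this]
          nlinarith [Real.pi_gt_three]
      _ ≤ _ := by
          gcongr
          exact ofReal_mul_enorm_rpow_le_setLIntegral_ball hp (by positivity)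
            (hf.1.mono ((hball n).trans hJ))
  rw [setLIntegral_discreteMeasure hmem]
  calc _ ≤ ∑' n, ENNReal.ofReal (8 / ε) * ∫⁻ z in Metric.ball (s n) (ε / 2), ‖f z‖ₑ ^ p :=
        ENNReal.tsum_le_tsum hpt
    _ = ENNReal.ofReal (8 / ε) * ∫⁻ z in ⋃ n, Metric.ball (s n) (ε / 2), ‖f z‖ₑ ^ p := by
        rw [ENNReal.tsum_mul_left, lintegral_iUnion (fun _ => Metric.isOpen_ball.measurableSet)
          hdisj]
    _ ≤ ENNReal.ofReal (8 / ε) * ∫⁻ σ in J, ∫⁻ t : ℝ, ‖f (σ + t * Complex.I)‖ₑ ^ p := by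
        gcongr
        exact (lintegral_mono_set (Set.iUnion_subset hball)).trans
          (setLIntegral_re_mem_le _ J)
    _ ≤ ENNReal.ofReal (8 / ε) * ∫⁻ _ in J, hardyNorm p f ^ p := by
        refine mul_le_mul' le_rfl (setLIntegral_mono' measurableSet_Ioo fun σ hσ => ?_)
        exact lintegral_vertical_le_hardyNorm hp0 f (by linarith [hσ.1])
    _ = _ := by
        simp only [J, lintegral_const, Measure.restrict_apply_univ, Real.volume_Ioo]
        rw [mul_comm (hardyNorm p f ^ p), ← mul_assoc, ← ENNReal.ofReal_mul (by positivity)]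
        congr 1
        rw [show 8 / ε * (1 / 2 + 3 * ε / 2 - (1 / 2 + ε / 2)) = 8 by field_simp; ring]
        simp

theorem setLIntegral_Ico_le_sum (h : ℝ → ℝ≥0∞) (x : ℝ) {ε : ℝ} (hε : 0 ≤ ε) (N : ℕ) :
    ∫⁻ t in Set.Ico x (x + N * ε), h t ≤
      ∑ n : Fin N, ∫⁻ θ in Set.Ico 0 ε, h (θ + (x + (n : ℕ) * ε)) := by
  rw [Fin.sum_univ_eq_sum_range (fun n : ℕ => ∫⁻ θ in Set.Ico 0 ε, h (θ + (x + n * ε)))]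
  induction N with
  | zero => simp
  | succ N ih =>
    rw [Finset.sum_range_succ, setLIntegral_Ico_comp_add_right,
      ← Set.Ico_union_Ico_eq_Ico (b := x + N * ε) (le_add_of_nonneg_right (by positivity))
        (by push_cast; nlinarith)]
    refine (lintegral_union_le _ _ _).trans (add_le_add ih (le_of_eq ?_))
    congr 3
    · ring
    · push_cast; ring

/-- The local embedding on `[-L, L)`, from the uniform Carleson inequality for discrete measures on a
rectangle. It is applied to grids of mesh `ε = 2L/(N+1)` on the line `σ = 1/2 + ε`; averaging over the
offset `θ ∈ [0, ε)` of the grid turns the sum into an integral, and `N → ∞` moves the line to the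
boundary. -/
theorem setLIntegral_dirichletPoly_le_of_discrete {p : ℝ} (hp : 1 ≤ p) {L : ℝ} (hL : 0 < L)
    {D : ℝ≥0}
    (hD : ∀ (N : ℕ) (s : Fin N → ℂ),
      (∀ n, s n ∈ {z : ℂ | 1 / 2 < z.re ∧ z.re ≤ 1 / 2 + 2 * L ∧ |z.im| ≤ L}) →
      HardyCarlesonBound p (discreteMeasure s) 8 →
      DirichletHardyCarlesonBound p (discreteMeasure s) (8 * D)) (a : ℕ+ →₀ ℂ) :
    ∫⁻ t in Set.Ico (-L) L, ‖dirichletPoly a (1 / 2 + t * Complex.I)‖ₑ ^ p ≤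
      (4 * D : ℝ≥0) * polyNorm p a ^ p := by
  have hp0 : 0 < p := by linarith
  have hc := continuous_dirichletPoly a
  set B := polyNorm p a ^ p
  set ε : ℕ → ℝ := fun N => 2 * L / (N + 1 : ℕ) with hε
  have hε0 (N : ℕ) : 0 < ε N := by positivity
  have hεN (N : ℕ) : (N + 1 : ℕ) * ε N = 2 * L := by simp only [hε]; field_simp
  set h : ℕ → ℝ → ℝ≥0∞ := fun N t =>
    ‖dirichletPoly a ((1 / 2 + ε N : ℝ) + t * Complex.I)‖ₑ ^ p with hh
  have hhm (N : ℕ) : Measurable (h N) :=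
    Measurable.pow_const (Continuous.measurable (by fun_prop)) _
  have hstep (N : ℕ) : ∫⁻ t in Set.Ico (-L) L, h N t ≤ (4 * D : ℝ≥0) * B := by
    have hθ : ∀ θ ∈ Set.Ico 0 (ε N), ∑ n : Fin (N + 1), h N (θ + (-L + (n : ℕ) * ε N)) ≤
        (ENNReal.ofReal (2 * ε N))⁻¹ * ((8 * D : ℝ≥0) * B) := by
      intro θ hθ
      set t : Fin (N + 1) → ℝ := fun n => θ + (-L + (n : ℕ) * ε N) with ht
      have hsep : ∀ i j, i ≠ j → ε N ≤ |t i - t j| := by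
        intro i j hij
        have h1 : t i - t j = (((i : ℕ) : ℤ) - ((j : ℕ) : ℤ) : ℤ) * ε N := by
          simp only [ht]
          push_cast
          ring
        have h2 : (1 : ℝ) ≤ |((((i : ℕ) : ℤ) - ((j : ℕ) : ℤ) : ℤ) : ℝ)| := by
          rw [← Int.cast_abs, ← Int.cast_one, Int.cast_le]
          exact Int.one_le_abs (sub_ne_zero.2 fun hv => hij (Fin.ext (Int.ofNat_inj.1 hv)))
        rw [h1, abs_mul, abs_of_pos (hε0 N)]
        nlinarith [hε0 N]
      set s : Fin (N + 1) → ℂ := fun n => ((1 / 2 + ε N : ℝ) : ℂ) + t n * Complex.I with hs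
      have hre (n) : (s n).re = 1 / 2 + ε N := by simp [hs]
      have him (n) : (s n).im = t n := by simp [hs]
      have hmem : ∀ n, s n ∈ {z : ℂ | 1 / 2 < z.re ∧ z.re ≤ 1 / 2 + 2 * L ∧ |z.im| ≤ L} := by
        intro n
        have hn : ((n : ℕ) : ℝ) ≤ N := by exact_mod_cast Nat.lt_succ_iff.1 n.2
        have hn0 : (0 : ℝ) ≤ ((n : ℕ) : ℝ) := Nat.cast_nonneg _
        have hN := hεN N
        push_cast at hN
        have hle : ((n : ℕ) : ℝ) * ε N ≤ N * ε N := by have := hε0 N; gcongr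
        have hge : 0 ≤ ((n : ℕ) : ℝ) * ε N := mul_nonneg hn0 (hε0 N).le
        have hNe : 0 ≤ (N : ℝ) * ε N := mul_nonneg (Nat.cast_nonneg _) (hε0 N).le
        refine ⟨by rw [hre]; linarith [hε0 N], by rw [hre]; linarith, ?_⟩
        rw [him, abs_le]
        simp only [ht]
        constructor <;> linarith [hθ.1, hθ.2]
      have hb := hD (N + 1) s hmem (hardyCarlesonBound_of_separated hp (hε0 N) hsep)
        (dirichletPoly a) ⟨_, approximates_dirichletPoly hp0 a⟩
      rw [setLIntegral_discreteMeasure fun n => (hmem n).1, tsum_fintype] at hb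
      simp only [hre] at hb
      rw [← Finset.mul_sum, show 2 * (1 / 2 + ε N) - 1 = 2 * ε N by ring] at hb
      have hpos : ENNReal.ofReal (2 * ε N) ≠ 0 := by simpa using hε0 N
      rw [← ENNReal.mul_le_iff_le_inv hpos ENNReal.ofReal_ne_top]
      refine hb.trans ?_
      gcongr
      exact ENNReal.rpow_le_rpow (dirichletHardyNorm_dirichletPoly_le hp0 a) hp0.le
    have hIco : Set.Ico (-L) L = Set.Ico (-L) (-L + (N + 1 : ℕ) * ε N) := by
      rw [hεN]
      congr 1
      ring
    calc ∫⁻ t in Set.Ico (-L) L, h N t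
        ≤ ∑ n : Fin (N + 1), ∫⁻ θ in Set.Ico 0 (ε N), h N (θ + (-L + (n : ℕ) * ε N)) := by
          rw [hIco]
          exact setLIntegral_Ico_le_sum (h N) (-L) (hε0 N).le (N + 1)
      _ = ∫⁻ θ in Set.Ico 0 (ε N), ∑ n : Fin (N + 1), h N (θ + (-L + (n : ℕ) * ε N)) :=
          (lintegral_finsetSum _ fun n _ => (hhm N).comp (measurable_add_const _)).symm
      _ ≤ ∫⁻ _ in Set.Ico 0 (ε N), (ENNReal.ofReal (2 * ε N))⁻¹ * ((8 * D : ℝ≥0) * B) :=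
          setLIntegral_mono' measurableSet_Ico hθ
      _ = _ := by
          rw [lintegral_const, Measure.restrict_apply_univ, Real.volume_Ico, sub_zero,
            ← ENNReal.ofReal_inv_of_pos (by have := hε0 N; positivity), mul_comm, ← mul_assoc,
            ← ENNReal.ofReal_mul (hε0 N).le, ← mul_assoc]
          congr 1
          have : ε N * (2 * ε N)⁻¹ = (2 : ℝ)⁻¹ := by have := (hε0 N).ne'; field_simp
          rw [this, ENNReal.ofReal_inv_of_pos two_pos, ENNReal.ofReal_ofNat]
          push_cast
          rw [show (8 : ℝ≥0∞) = 2 * 4 by norm_num, ← mul_assoc, ← mul_assoc,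
            ENNReal.inv_mul_cancel (by norm_num) (by norm_num), one_mul]
  have hεlim : Tendsto ε atTop (𝓝 0) :=
    (tendsto_const_div_atTop_nhds_zero_nat (2 * L)).comp (tendsto_add_atTop_nat 1)
  calc ∫⁻ t in Set.Ico (-L) L, ‖dirichletPoly a (1 / 2 + t * Complex.I)‖ₑ ^ p
      = ∫⁻ t in Set.Ico (-L) L, liminf (fun N => h N t) atTop := by
        refine lintegral_congr fun t => ?_
        have hcont : Continuous fun e : ℝ =>
            ‖dirichletPoly a ((1 / 2 + e : ℝ) + t * Complex.I)‖ₑ ^ p :=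
          ENNReal.continuous_rpow_const.comp (by fun_prop)
        have := ((hcont.tendsto 0).comp hεlim).liminf_eq
        simpa [Function.comp_def, hh] using this.symm
    _ ≤ liminf (fun N => ∫⁻ t in Set.Ico (-L) L, h N t) atTop := lintegral_liminf_le hhm
    _ ≤ liminf (fun _ : ℕ => (4 * D : ℝ≥0) * B) atTop :=
        liminf_le_liminf (Eventually.of_forall hstep)
    _ = _ := liminf_const _

theorem isBounded_rectangle (L : ℝ) :
    Bornology.IsBounded {z : ℂ | 1 / 2 < z.re ∧ z.re ≤ 1 / 2 + 2 * L ∧ |z.im| ≤ L} := by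
  refine isBounded_iff_forall_norm_le.2 ⟨1 / 2 + 2 * L + L, fun z hz => ?_⟩
  refine (Complex.norm_le_abs_re_add_abs_im z).trans (add_le_add ?_ hz.2.2)
  rw [abs_of_pos (by linarith [hz.1])]
  exact hz.2.1

/-- The local embedding on all intervals of length `ℓ`. A bound from a fixed rectangle suffices,
because the interval can be moved to the origin by a vertical translation. -/
theorem exists_local_embedding_of_discrete {p : ℝ} (hp : 1 ≤ p)
    (hc : ∀ Γ : Set ℂ, Γ ⊆ halfPlane → Bornology.IsBounded Γ →
      ∃ D : ℝ≥0, 0 < D ∧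
        ∀ (ι : Type) [Countable ι] (s : ι → ℂ), (∀ n, s n ∈ Γ) →
          ∀ C : ℝ≥0, 0 < C → HardyCarlesonBound p (discreteMeasure s) C →
            DirichletHardyCarlesonBound p (discreteMeasure s) (C * D)) (ℓ : ℝ≥0) :
    ∃ C : ℝ≥0, 0 < C ∧
      ∀ I : Set ℝ, I.OrdConnected → Bornology.IsBounded I → volume I = ℓ →
        ∀ a : ℕ+ →₀ ℂ,
          ∫⁻ t in I, ‖dirichletPoly a (1 / 2 + t * Complex.I)‖ₑ ^ p ≤ C * polyNorm p a ^ p := by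
  -- the summand `1` keeps the half-open interval large enough and `L` positive
  set L : ℝ := ℓ + 1
  have hL : 0 < L := by positivity
  obtain ⟨D, hD0, hD⟩ := hc _ (fun z hz => hz.1) (isBounded_rectangle L)
  refine ⟨4 * D, by positivity, fun I hI _ hvol a => ?_⟩
  rcases I.eq_empty_or_nonempty with rfl | ⟨y, hy⟩
  · simp
  -- an interval of length `ℓ` through `y` lies within distance `ℓ` of `y`
  have hsub : I ⊆ Set.Ico (-L + y) (L + y) := by
    intro x hx
    have hxy : |y - x| ≤ ℓ := by
      have h1 : volume (Set.uIcc x y) ≤ ℓ := hvol ▸ measure_mono (hI.uIcc_subset hx hy)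
      rw [Real.volume_interval, ENNReal.ofReal_le_iff_le_toReal ENNReal.coe_ne_top] at h1
      exact h1
    rw [abs_le] at hxy
    constructor <;> linarith [hxy.1, hxy.2]
  calc ∫⁻ t in I, ‖dirichletPoly a (1 / 2 + t * Complex.I)‖ₑ ^ p
      ≤ ∫⁻ t in Set.Ico (-L + y) (L + y), ‖dirichletPoly a (1 / 2 + t * Complex.I)‖ₑ ^ p :=
        lintegral_mono_set hsub
    _ = ∫⁻ t in Set.Ico (-L) L,
          ‖dirichletPoly (verticalShift y a) (1 / 2 + t * Complex.I)‖ₑ ^ p := by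
        rw [← setLIntegral_Ico_comp_add_right]
        refine lintegral_congr fun t => ?_
        rw [dirichletPoly_verticalShift]
        push_cast
        ring_nf
    _ ≤ (4 * D : ℝ≥0) * polyNorm p (verticalShift y a) ^ p :=
        setLIntegral_dirichletPoly_le_of_discrete hp hL
          (fun N s hs hH => hD (Fin N) s hs 8 (by norm_num) hH) _
    _ ≤ _ := by
        gcongr
        exact polyNorm_verticalShift_le hp y a

end DirichletHardy

theorem theorem4 (p : ℝ) (hp : 1 ≤ p) :
    List.TFAE [
      -- (a) the local embedding, with a constant that depends only on the length of the interval
      ∀ ℓ : ℝ≥0, ∃ C : ℝ≥0, 0 < C ∧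
        ∀ I : Set ℝ, I.OrdConnected → Bornology.IsBounded I → volume I = ℓ →
          ∀ a : ℕ+ →₀ ℂ,
            ∫⁻ t in I, ‖DirichletHardy.dirichletPoly a (1 / 2 + t * Complex.I)‖ₑ ^ p
              ≤ C * DirichletHardy.polyNorm p a ^ p,
      -- (b) local Carleson measures for the classical space are Carleson for the Dirichlet one
      ∀ μ : Measure ℂ, DirichletHardy.IsLocalMeasure μ →
        DirichletHardy.IsHardyCarleson p μ → DirichletHardy.IsDirichletHardyCarleson p μ,
      -- (c) discrete measures, with a constant that is uniform on each bounded set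
      ∀ Γ : Set ℂ, Γ ⊆ DirichletHardy.halfPlane → Bornology.IsBounded Γ →
        ∃ D : ℝ≥0, 0 < D ∧
          ∀ (ι : Type) [Countable ι] (s : ι → ℂ), (∀ n, s n ∈ Γ) →
            ∀ C : ℝ≥0, 0 < C →
              DirichletHardy.HardyCarlesonBound p (DirichletHardy.discreteMeasure s) C →
              DirichletHardy.DirichletHardyCarlesonBound p
                (DirichletHardy.discreteMeasure s) (C * D)] := by
  tfae_have 1 → 2 := by
    intro ha μ hμ hC
    obtain ⟨C₁, hC₁, h⟩ := ha 1
    exact DirichletHardy.isDirichletHardyCarleson_of_local hp hC₁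
      (fun a x => h _ Set.ordConnected_Ico (Metric.isBounded_Ico _ _) (by simp) a) hμ hC
  tfae_have 2 → 3 := fun hb Γ hΓ hbd =>
    DirichletHardy.exists_uniform_bound_of_forall_local hb hΓ hbd
  tfae_have 3 → 1 := fun hc ℓ => DirichletHardy.exists_local_embedding_of_discrete hp hc ℓ
  tfae_finish

end
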